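/- Let $(X,|\cdot|)$ be a real Banach space and let $K\subset X$ be a nondegenerate cone, i.e. a closed convex set with $\lambda K\subset K$ for all $\lambda\ge 0$ and $K\setminus\{0\}\ne\emptyset$. Put $K_1=\{v\in K: |v|=1\}$. Let $T:K\to K$ be completely continuous (continuous, and mapping bounded sets to relatively compact sets), and let $\mathcal F:K\times K\times K_1\to\mathbb R$ be continuous. For $v\in K_1$ define the radial energy $$\mathcal E(v):(0,\infty)\to\mathbb R,\qquad \mathcal E(v)(t)=\int_0^t \mathcal F(T(sv),sv,v)\,ds .$$ Let $0\le r<R\le\infty$, and let $[r,R]$ stand for $\{t\in(0,\infty): r\le t\le R\}$, the part of the interval on which $\mathcal E(v)$ is defined. Assume: (h1) there exist real numbers $r_0>0$ and $R_0<\infty$ with $r\le r_0<R_0\le R$ such that, for every $v\in K_1$, the function $\mathcal E(v)$ attains its maximum on $[r,R]$ at a unique point $t_v$, and $r_0<t_v<R_0$; (h5) if $\mathcal F\left(tu,u,\frac{u}{|u|}\right)=0$ for some $t>0$ and $u\in K\setminus\{0\}$, then $t\le 1$. Let $U=\{tv: v\in K_1,\ 0\le t<t_v\}$. Then $T$ has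 a fixed point in $\overline U$. -/

import Mathlib

namespace Nehari

open Set

variable {X : Type*} [NormedAddCommGroup X] [NormedSpace ℝ X]

/-- `K_ρ`: the vectors of norm `ρ` in the cone `K`. -/
def coneSphere (K : ProperCone ℝ X) (ρ : ℝ) : Set X := {v | v ∈ K ∧ ‖v‖ = ρ}

/-- `T` is a completely continuous operator from `K` to `K`: it is continuous on `K` and maps
bounded subsets of `K` to relatively compact sets. Values of `T` outside `K` are irrelevant. -/
structure IsCompletelyContinuous (K : ProperCone ℝ X) (T : X → X) : Prop where
  mapsTo : MapsTo T K K
  continuousOn : ContinuousOn T K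
  compact : ∀ B : Set X, B ⊆ K → Bornology.IsBounded B → IsCompact (closure (T '' B))

/-- The functional `F` is continuous on `K × K × K₁`. Values elsewhere are irrelevant. -/
def IsContinuousFunctional (K : ProperCone ℝ X) (F : X → X → X → ℝ) : Prop :=
  ContinuousOn (fun p : X × X × X => F p.1 p.2.1 p.2.2)
    ((K : Set X) ×ˢ (K : Set X) ×ˢ coneSphere K 1)

/-- The radial energy `𝓔(v)(t) = ∫₀ᵗ F(T(sv), sv, v) ds` in the direction `v`. -/
noncomputable def radialEnergy (T : X → X) (F : X → X → X → ℝ) (v : X) (t : ℝ) : ℝ :=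
  ∫ s in (0 : ℝ)..t, F (T (s • v)) (s • v) v

/-- The part of `[r, R]` (with `R = ∞` allowed) in the domain `(0, ∞)` of the radial energies. -/
def radialInterval (r : ℝ) (R : EReal) : Set ℝ := {t | 0 < t ∧ r ≤ t ∧ (t : EReal) ≤ R}

/-- `t = t_v`: the maximum of `𝓔(v)` on `[r, R]` is attained at `t` and at no other point. -/
def IsUniqueMaximizer (T : X → X) (F : X → X → X → ℝ) (r : ℝ) (R : EReal) (v : X) (t : ℝ) :
    Prop :=
  t ∈ radialInterval r R ∧
    IsMaxOn (radialEnergy T F v) (radialInterval r R) t ∧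
    ∀ s ∈ radialInterval r R, IsMaxOn (radialEnergy T F v) (radialInterval r R) s → s = t

/-- The radial condition: every radial energy has its unique maximum point in `(r₀, R₀)`. -/
def H1 (K : ProperCone ℝ X) (T : X → X) (F : X → X → X → ℝ) (r : ℝ) (R : EReal) : Prop :=
  ∃ r₀ R₀ : ℝ, 0 < r₀ ∧ r ≤ r₀ ∧ r₀ < R₀ ∧ (R₀ : EReal) ≤ R ∧
    ∀ v ∈ coneSphere K 1, ∃ t, IsUniqueMaximizer T F r R v t ∧ r₀ < t ∧ t < R₀

/-- If `F(tu, u, u/|u|) = 0` with `t > 0` and `u ∈ K \ {0}`, then `t ≤ 1`. -/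
def H5 (K : ProperCone ℝ X) (F : X → X → X → ℝ) : Prop :=
  ∀ t : ℝ, 0 < t → ∀ u ∈ K, u ≠ 0 → F (t • u) u (‖u‖⁻¹ • u) = 0 → t ≤ 1

/-- `U = {t v : v ∈ K₁, 0 ≤ t < t_v}`. -/
def U (K : ProperCone ℝ X) (T : X → X) (F : X → X → X → ℝ) (r : ℝ) (R : EReal) : Set X :=
  {u | ∃ v ∈ coneSphere K 1, ∃ t_v, IsUniqueMaximizer T F r R v t_v ∧
    ∃ t : ℝ, 0 ≤ t ∧ t < t_v ∧ u = t • v}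

end Nehari

/-! The radius t_v depends continuously on v: a limit of maximizers stays in [r₀, R₀] and is again a
maximizer, hence the unique one. So the radial retraction ρ, which fixes x when |x| ≤ t_v and
otherwise moves it to t_v v (v = x/|x|), is continuous on `K` with bounded image, and T ∘ ρ maps `K`
into a compact subset of `K`. Schauder gives x = T(ρ x). If ρ does not move x, then x is a fixed
point of `T` in the closure of `U`. Otherwise, with u = t_v v, T u = x = λu where λ = |x|/t_v > 1.
But the energy has zero derivative at its interior maximum, so F(λu, u, v) = 0, against (h5).

Schauder is reduced to Brouwer on a simplex by projecting onto a finite ε-net. Brouwer comes from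
Scarf's lemma, a parity argument applied to a grid in the simplex where a point x gets a colour i
with x_i ≤ f(x)_i. -/

section Scarf

/-! ### Scarf's lemma by a parity count. -/

open Finset

variable {I Y α : Type*} [LinearOrder α]

/-- A finite set `A` is dominant for the family of orders induced by `g` if no element exceeds
the minimum of `A` in every one of the orders. -/
def IsDominant (g : I → Y → α) (A : Finset Y) : Prop :=
  ∀ y, ∃ i, ∀ a ∈ A, g i y ≤ g i a

/-- A family of linear orders with slack elements `e i`: `e i` is the least element of the `i`-th
order and lies above all non-slack elements in the other orders. -/
structure IsSlackSystem (g : I → Y → α) (e : I → Y) : Prop where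
  injective : ∀ i, Function.Injective (g i)
  slack_le : ∀ i y, g i (e i) ≤ g i y
  lt_slack : ∀ i j y, j ≠ i → y ∉ Set.range e → g i y < g i (e j)

theorem IsDominant.mono {g : I → Y → α} {A B : Finset Y} (hA : IsDominant g A) (h : B ⊆ A) :
    IsDominant g B := fun y => by
  obtain ⟨i, hi⟩ := hA y
  exact ⟨i, fun a ha => hi a (h ha)⟩

variable [Fintype I] [DecidableEq I] [Fintype Y] [DecidableEq Y]

open Classical in
/-- A dominant set with one element fewer than there are orders, not made of slack elements
only, extends in exactly two ways to a dominant set with as many elements as orders. -/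
theorem IsDominant.card_extensions {g : I → Y → α} {e : I → Y} (h : IsSlackSystem g e)
    {B : Finset Y} (hB : IsDominant g B) (hcard : #B + 1 = Fintype.card I)
    (hne : ∃ b ∈ B, b ∉ Set.range e) :
    #{A : Finset Y | (IsDominant g A ∧ #A = Fintype.card I) ∧ B ⊆ A} = 2 := by
  obtain ⟨b₀, hb₀, hb₀e⟩ := hne
  have hmin : ∀ i, ∃ m ∈ B, ∀ b ∈ B, g i m ≤ g i b := fun i =>
    B.exists_min_image (g i) ⟨b₀, hb₀⟩
  choose m hmB hm using hmin
  have surj : ∀ b ∈ B, ∃ i, m i = b := fun b hb => by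
    obtain ⟨i, hi⟩ := hB b
    exact ⟨i, h.injective i (le_antisymm (hm i b hb) (hi _ (hmB i)))⟩
  -- Every element of `B` is the minimum in some order, and there is one order more than elements,
  -- so two orders `i`, `j` share their minimum. An added element has to take over one of these two.
  obtain ⟨i, -, j, -, hij, hmij⟩ := Finset.exists_ne_map_eq_of_card_lt_of_maps_to
    (s := (univ : Finset I)) (t := B) (f := m) (by rw [card_univ]; omega) (fun i _ => hmB i)
  have surj' : ∀ k, k = i ∨ k = j → ∀ b ∈ B, ∃ l, l ≠ k ∧ m l = b := by
    intro k hk b hb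
    obtain ⟨l, hl⟩ := surj b hb
    by_cases hlk : l = k
    · rcases hk with rfl | rfl
      · exact ⟨j, hij.symm, by rw [← hl, hlk, hmij]⟩
      · exact ⟨i, hij, by rw [← hl, hlk, hmij]⟩
    · exact ⟨l, hlk, hl⟩
  have extend : ∀ k, k = i ∨ k = j → ∃ x, x ∉ B ∧ IsDominant g (insert x B) ∧
      (∀ l, l ≠ k → g l (m l) < g l x) ∧
      ∀ y, (∀ l, l ≠ k → g l (m l) < g l y) → IsDominant g (insert y B) → y = x := by
    intro k hk
    -- Dominance forces the element taking over order `k` to be the `k`-largest among those above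
    -- the minima of `B` in all other orders; `e k` is a candidate.
    obtain ⟨x, hxM, hx⟩ := Finset.exists_max_image
      ({x : Y | ∀ l, l ≠ k → g l (m l) < g l x} : Finset Y) (g k)
      ⟨e k, by
        simp only [mem_filter, mem_univ, true_and]
        exact fun l hl => (hm l b₀ hb₀).trans_lt (h.lt_slack l k b₀ hl.symm hb₀e)⟩
    simp only [mem_filter, mem_univ, true_and] at hxM hx
    refine ⟨x, fun hxB => ?_, fun y => ?_, hxM, fun y hy hdom => ?_⟩
    · obtain ⟨l, hl, rfl⟩ := surj' k hk x hxB
      exact lt_irrefl _ (hxM l hl)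
    · by_cases hy : ∀ l, l ≠ k → g l (m l) < g l y
      · obtain ⟨p, hp⟩ := hB y
        have hpk : p = k := by
          by_contra hpk
          exact (hy p hpk).not_ge (hp _ (hmB p))
        subst hpk
        refine ⟨p, fun a ha => ?_⟩
        rcases mem_insert.1 ha with rfl | ha
        · exact hx y hy
        · exact hp a ha
      · push Not at hy
        obtain ⟨l, hl, hly⟩ := hy
        refine ⟨l, fun a ha => ?_⟩
        rcases mem_insert.1 ha with rfl | ha
        · exact hly.trans (hxM l hl).le
        · exact hly.trans (hm l a ha)
    · obtain ⟨p, hp⟩ := hdom x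
      have hpk : p = k := by
        by_contra hpk
        exact (hxM p hpk).not_ge (hp _ (mem_insert_of_mem (hmB p)))
      subst hpk
      exact h.injective p (le_antisymm (hx y hy) (hp y (mem_insert_self _ _)))
  have either : ∀ y, y ∉ B → IsDominant g (insert y B) →
      (∀ l, l ≠ i → g l (m l) < g l y) ∨ (∀ l, l ≠ j → g l (m l) < g l y) := by
    intro y hy hdom
    by_contra hcon
    push Not at hcon
    obtain ⟨⟨p, hpi, hp⟩, q, hqj, hq⟩ := hcon
    -- If `y` is low in orders `p` and `q`, the minima in the remaining orders must still exhaust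
    -- `B`. There are too few of them if `p ≠ q`; if `p = q`, both `i` and `j` remain and repeat an
    -- element.
    have key : ∀ b ∈ B, ∃ l, l ≠ p ∧ l ≠ q ∧ m l = b := by
      intro b hb
      obtain ⟨l, hl⟩ := hdom b
      have hlb : m l = b :=
        h.injective l (le_antisymm (hm l b hb) (hl _ (mem_insert_of_mem (hmB l))))
      have hne : ∀ s, g s y ≤ g s (m s) → l ≠ s := by
        rintro s hs rfl
        have := hl y (mem_insert_self _ _)
        rw [← hlb] at this
        exact hy (h.injective l (le_antisymm hs this) ▸ hmB l)
      exact ⟨l, hne p hp, hne q hq, hlb⟩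
    have hsub : B ⊆ ((univ.erase p).erase q).image m := fun b hb => by
      obtain ⟨l, hlp, hlq, rfl⟩ := key b hb
      exact mem_image_of_mem _ (by simp [hlp, hlq])
    by_cases hpq : p = q
    · subst hpq
      have himg : #((univ.erase p).image m) = #(univ.erase p) := by
        refine le_antisymm card_image_le ?_
        rw [card_erase_of_mem (mem_univ _), card_univ]
        have := card_le_card (hsub.trans (image_subset_image (erase_subset _ _)))
        omega
      exact hij (card_image_iff.1 himg (by simpa using hpi.symm) (by simpa using hqj.symm) hmij)
    · have h1 := (card_le_card hsub).trans card_image_le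
      rw [card_erase_of_mem (by simp [Ne.symm hpq]), card_erase_of_mem (mem_univ _),
        card_univ] at h1
      have : 1 < Fintype.card I := Fintype.one_lt_card_iff.2 ⟨p, q, hpq⟩
      omega
  obtain ⟨x, hxB, hxd, hxM, hxu⟩ := extend i (.inl rfl)
  obtain ⟨z, hzB, hzd, hzM, hzu⟩ := extend j (.inr rfl)
  have hxz : x ≠ z := by
    rintro rfl
    obtain ⟨p, hp⟩ := hB x
    by_cases hpi : p = i
    · exact (hzM p (hpi ▸ hij)).not_ge (hp _ (hmB p))
    · exact (hxM p hpi).not_ge (hp _ (hmB p))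
  have : ({A : Finset Y | (IsDominant g A ∧ #A = Fintype.card I) ∧ B ⊆ A} : Finset (Finset Y)) =
      {insert x B, insert z B} := by
    ext A
    simp only [mem_filter, mem_univ, true_and, mem_insert, mem_singleton]
    constructor
    · rintro ⟨⟨hA, hAc⟩, hBA⟩
      obtain ⟨y, hy, rfl⟩ := Finset.exists_eq_insert_iff.2 ⟨hBA, by omega⟩
      rcases either y hy hA with h' | h'
      · exact .inl (by rw [hxu y h' hA])
      · exact .inr (by rw [hzu y h' hA])
    · rintro (rfl | rfl)
      · exact ⟨⟨hxd, by rw [card_insert_of_notMem hxB, hcard]⟩, subset_insert _ _⟩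
      · exact ⟨⟨hzd, by rw [card_insert_of_notMem hzB, hcard]⟩, subset_insert _ _⟩
  rw [this, card_pair]
  intro heq
  have := heq ▸ mem_insert_self x B
  rcases mem_insert.1 this with h' | h'
  · exact hxz h'
  · exact hxB h'

open Classical in
/-- The set of all slack elements but one extends in exactly one way to a dominant set with as
many elements as orders. -/
theorem IsSlackSystem.card_extensions_slack {g : I → Y → α} {e : I → Y}
    (h : IsSlackSystem g e) (he : Function.Injective e) (hne : ∃ y, y ∉ Set.range e) (i₀ : I) :
    #{A : Finset Y | (IsDominant g A ∧ #A = Fintype.card I) ∧ (univ.erase i₀).image e ⊆ A}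
      = 1 := by
  set B := (univ.erase i₀).image e with hBdef
  have hmemB : ∀ l, l ≠ i₀ → e l ∈ B := fun l hl => mem_image_of_mem _ (by simp [hl])
  have hI : 0 < Fintype.card I := Fintype.card_pos_iff.2 ⟨i₀⟩
  have hcard : #B + 1 = Fintype.card I := by
    rw [hBdef, card_image_of_injective _ he, card_erase_of_mem (mem_univ _), card_univ]
    omega
  have hlt : ∀ i y, y ∉ Set.range e → g i (e i) < g i y := fun i y hy =>
    lt_of_le_of_ne (h.slack_le i y) fun heq => hy ⟨i, h.injective i heq⟩
  obtain ⟨x, hx, hmax⟩ := Finset.exists_max_image ({y : Y | y ∉ Set.range e} : Finset Y) (g i₀)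
    (by obtain ⟨y, hy⟩ := hne; exact ⟨y, by simpa using hy⟩)
  have hxe : x ∉ Set.range e := (mem_filter.1 hx).2
  have hmax' : ∀ y, y ∉ Set.range e → g i₀ y ≤ g i₀ x := fun y hy =>
    hmax y (mem_filter.2 ⟨mem_univ _, hy⟩)
  have hxB : x ∉ B := fun hxB => by
    obtain ⟨l, -, hl⟩ := mem_image.1 hxB
    exact hxe ⟨l, hl⟩
  rw [card_eq_one]
  refine ⟨insert x B, ?_⟩
  ext A
  simp only [mem_filter, mem_univ, true_and, mem_singleton]
  constructor
  · rintro ⟨⟨hA, hAc⟩, hBA⟩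
    obtain ⟨y, hy, rfl⟩ := Finset.exists_eq_insert_iff.2 ⟨hBA, by omega⟩
    obtain ⟨p, hp⟩ := hA x
    have hpi : p = i₀ := by
      by_contra hpi
      exact (hlt p x hxe).not_ge (hp _ (mem_insert_of_mem (hmemB p hpi)))
    subst hpi
    have hxy := hp y (mem_insert_self _ _)
    have hye : y ∉ Set.range e := by
      rintro ⟨l, rfl⟩
      by_cases hl : l = p
      · subst hl; exact (hlt l x hxe).not_ge hxy
      · exact hy (hmemB l hl)
    rw [h.injective p (le_antisymm (hmax' y hye) hxy)]
  · rintro rfl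
    refine ⟨⟨fun y => ?_, by rw [card_insert_of_notMem hxB, hcard]⟩, subset_insert _ _⟩
    by_cases hy : y ∈ Set.range e
    · obtain ⟨l, rfl⟩ := hy
      exact ⟨l, fun a _ => h.slack_le l a⟩
    · refine ⟨i₀, fun a ha => ?_⟩
      rcases mem_insert.1 ha with rfl | ha
      · exact hmax' y hy
      · obtain ⟨l, hl, rfl⟩ := mem_image.1 ha
        exact (h.lt_slack i₀ l y (by simpa using hl) hy).le

open Classical in
/-- A set with as many elements as colours that does not carry all colours has an even number of
facets that carry exactly the colours other than `i₀`. -/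
theorem even_card_facets (c : Y → I) (i₀ : I) {A : Finset Y} (hA : #A = Fintype.card I)
    (hc : A.image c ≠ univ) :
    Even #{B : Finset Y | (#B + 1 = Fintype.card I ∧ B.image c = univ.erase i₀) ∧ B ⊆ A} := by
  set D : Finset (Finset Y) :=
    {B : Finset Y | (#B + 1 = Fintype.card I ∧ B.image c = univ.erase i₀) ∧ B ⊆ A} with hD
  have hmem : ∀ B, B ∈ D ↔ (#B + 1 = Fintype.card I ∧ B.image c = univ.erase i₀) ∧ B ⊆ A := by
    simp [hD]
  have hinj : ∀ B ∈ D, Set.InjOn c B := fun B hB => by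
    obtain ⟨⟨h1, h2⟩, -⟩ := (hmem B).1 hB
    refine card_image_iff.1 ?_
    rw [h2, card_erase_of_mem (mem_univ _), card_univ]
    omega
  rcases D.eq_empty_or_nonempty with h0 | ⟨B, hB⟩
  · simp [h0]
  obtain ⟨⟨hBc, hBi⟩, hBA⟩ := (hmem B).1 hB
  obtain ⟨a, ha, rfl⟩ := Finset.exists_eq_insert_iff.2 ⟨hBA, by omega⟩
  -- So `a` repeats the colour of exactly one `b ∈ B`, and only dropping `a` or `b` leaves the
  -- required colours.
  have hca : c a ≠ i₀ := fun h => hc (by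
    rw [image_insert, hBi, h, insert_erase (mem_univ _)])
  obtain ⟨b, hb, hbc⟩ : ∃ b ∈ B, c b = c a := by
    have : c a ∈ B.image c := by rw [hBi]; simp [hca]
    simpa using this
  have hab : a ≠ b := fun h => ha (h ▸ hb)
  have : D = {B, (insert a B).erase b} := by
    ext Z
    simp only [mem_insert, mem_singleton]
    constructor
    · intro hZ
      obtain ⟨⟨hZc, hZi⟩, hZA⟩ := (hmem Z).1 hZ
      obtain ⟨z, hz, hzA⟩ := Finset.exists_eq_insert_iff.2 ⟨hZA, by omega⟩
      have hZe : Z = (insert a B).erase z := by rw [← hzA, erase_insert hz]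
      have hz' : z = a ∨ z = b := by
        by_contra hcon
        push Not at hcon
        have h1 : a ∈ Z := by rw [hZe]; simp [hcon.1.symm]
        have h2 : b ∈ Z := by rw [hZe]; simp [hcon.2.symm, hb]
        exact hab (hinj Z hZ h1 h2 hbc.symm)
      rcases hz' with rfl | rfl
      · exact .inl (by rw [hZe, erase_insert ha])
      · exact .inr hZe
    · rintro (rfl | rfl)
      · exact hB
      · rw [hmem]
        refine ⟨⟨?_, ?_⟩, erase_subset _ _⟩
        · rw [card_erase_of_mem (mem_insert_of_mem hb)]; omega
        · rw [← hBi]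
          ext k
          simp only [mem_image, mem_erase, mem_insert]
          constructor
          · rintro ⟨y, ⟨hyb, rfl | hy⟩, rfl⟩
            · exact ⟨b, hb, hbc⟩
            · exact ⟨y, hy, rfl⟩
          · rintro ⟨y, hy, rfl⟩
            by_cases hyb : y = b
            · exact ⟨a, ⟨hab, .inl rfl⟩, by rw [hyb, hbc]⟩
            · exact ⟨y, ⟨hyb, .inr hy⟩, rfl⟩
  rw [this, card_pair]
  · exact even_two
  · intro h
    exact notMem_erase b (insert a B) (h ▸ hb)

/-- **Scarf's lemma**: a coloured slack system contains a dominant set carrying all colours. -/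
theorem IsSlackSystem.exists_colorful {g : I → Y → α} {e : I → Y} (h : IsSlackSystem g e)
    (hne : ∃ y, y ∉ Set.range e) (c : Y → I) (hc : ∀ i, c (e i) = i) :
    ∃ A : Finset Y, IsDominant g A ∧ A.image c = univ := by
  classical
  by_contra hcon
  push Not at hcon
  obtain ⟨y, hy⟩ := hne
  have he : Function.Injective e := fun i j hij => by rw [← hc i, hij, hc]
  set i₀ := c y
  have hI : 0 < Fintype.card I := Fintype.card_pos_iff.2 ⟨i₀⟩
  set rooms : Finset (Finset Y) := {A | IsDominant g A ∧ #A = Fintype.card I} with hrooms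
  set doors : Finset (Finset Y) := {B | #B + 1 = Fintype.card I ∧ B.image c = univ.erase i₀}
    with hdoors
  -- Incidences of doors in rooms are counted twice. Without a colourful room each room has evenly
  -- many doors, while exactly one door, the slack one, lies in an odd number of rooms.
  have hcount := Finset.sum_card_bipartiteAbove_eq_sum_card_bipartiteBelow
    (s := doors) (t := rooms) (fun B A => B ⊆ A)
  have hright : Even (∑ A ∈ rooms, #(doors.bipartiteBelow (fun B A => B ⊆ A) A)) := by
    refine Finset.even_sum _ fun A hA => ?_
    have hA' := (mem_filter.1 hA).2
    have := even_card_facets c i₀ hA'.2 (hcon A hA'.1)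
    rwa [bipartiteBelow, hdoors, filter_filter]
  have hE : (univ.erase i₀).image e ∈ doors := by
    rw [hdoors, mem_filter]
    refine ⟨mem_univ _, ?_, ?_⟩
    · rw [card_image_of_injective _ he, card_erase_of_mem (mem_univ _), card_univ]
      omega
    · rw [image_image]
      have : c ∘ e = id := funext hc
      rw [this, image_id]
  rw [← hcount, ← Finset.add_sum_erase _ _ hE] at hright
  have h1 : #(rooms.bipartiteAbove (fun B A => B ⊆ A) ((univ.erase i₀).image e)) = 1 := by
    rw [bipartiteAbove, hrooms, filter_filter]
    exact h.card_extensions_slack he ⟨y, hy⟩ i₀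
  have h2 : Even (∑ B ∈ doors.erase ((univ.erase i₀).image e),
      #(rooms.bipartiteAbove (fun B A => B ⊆ A) B)) := by
    refine Finset.even_sum _ fun B hB => ?_
    obtain ⟨hBE, hB⟩ := mem_erase.1 hB
    obtain ⟨-, hBc, hBi⟩ := mem_filter.1 hB
    rw [bipartiteAbove, hrooms, filter_filter]
    by_cases hBd : IsDominant g B
    · rw [hBd.card_extensions h hBc]
      · exact even_two
      · by_contra hsub
        push Not at hsub
        refine hBE (eq_of_subset_of_card_le (fun b hb => ?_) ?_)
        · obtain ⟨l, rfl⟩ := hsub b hb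
          refine mem_image_of_mem _ ?_
          rw [← hBi, ← hc l]
          simpa [hc] using mem_image_of_mem c hb
        · have := (mem_filter.1 hE).2.1
          omega
    · rw [filter_eq_empty_iff.2]
      · simp
      · exact fun A _ hA => hBd (hA.1.1.mono hA.2)
  rw [h1] at hright
  rw [Nat.even_add] at hright
  exact absurd (hright.2 h2) (by decide)

end Scarf

/-! ### Brouwer's theorem on the simplex, via Scarf's lemma on a grid. -/

section Brouwer

open Finset Filter Topology

/-- Approximate fixed points on the standard simplex, at scale `1 / m`. -/
theorem exists_approx_fixedPoint_stdSimplex {I : Type*} [Fintype I] [Nonempty I]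
    {f : (I → ℝ) → I → ℝ} (hf : Set.MapsTo f (stdSimplex ℝ I) (stdSimplex ℝ I))
    {m : ℕ} (hm : 0 < m) :
    ∃ x ∈ stdSimplex ℝ I, ∀ i, ∃ b ∈ stdSimplex ℝ I,
      (∀ j, |b j - x j| ≤ Fintype.card I / m) ∧ b i ≤ f b i + Fintype.card I / m := by
  classical
  set n := Fintype.card I with hn
  have hm' : (0 : ℝ) < m := by exact_mod_cast hm
  let G := {k : I → ℕ // k ∈ piAntidiag (univ : Finset I) m}
  have hG : ∀ k : G, ∑ i, k.1 i = m := fun k => (mem_piAntidiag.1 k.2).1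
  let p : G → I → ℝ := fun k i => (k.1 i : ℝ) / m
  have hp : ∀ k, p k ∈ stdSimplex ℝ I := fun k => by
    refine ⟨fun i => by positivity, ?_⟩
    rw [← Finset.sum_div, ← Nat.cast_sum, hG k, div_self hm'.ne']
  have hcol : ∀ x ∈ stdSimplex ℝ I, ∃ i, x i ≤ f x i := fun x hx => by
    by_contra hcon
    push Not at hcon
    have := Finset.sum_lt_sum_of_nonempty (univ_nonempty (α := I)) fun i _ => hcon i
    rw [hx.2, (hf hx).2] at this
    exact lt_irrefl _ this
  choose c hc using fun k : G => hcol (p k) (hp k)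
  let v : I → G ⊕ I → ℤ := fun i => Sum.elim (fun k => (k.1 i : ℤ))
    (fun j => if j = i then -1 else m + 1)
  -- An enumeration breaks ties lexicographically, making the orders strict.
  let g : I → G ⊕ I → ℤ ×ₗ Fin (Fintype.card (G ⊕ I)) :=
    fun i y => toLex (v i y, Fintype.equivFin _ y)
  have hgv : ∀ i y z, g i y ≤ g i z → v i y ≤ v i z := fun i y z h => by
    rcases Prod.Lex.toLex_le_toLex.1 h with h | h
    · exact h.le
    · exact h.1.le
  have hvg : ∀ i y z, v i y < v i z → g i y < g i z := fun i y z h =>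
    Prod.Lex.toLex_lt_toLex.2 (.inl h)
  have hkm : ∀ (k : G) i, k.1 i ≤ m := fun k i =>
    (Finset.single_le_sum (f := k.1) (fun _ _ => Nat.zero_le _) (mem_univ i)).trans_eq (hG k)
  have hsys : IsSlackSystem g Sum.inr := by
    refine ⟨fun i y z h => ?_, fun i y => ?_, fun i j y hij hy => ?_⟩
    · exact (Fintype.equivFin _).injective (Prod.ext_iff.1 (toLex.injective h)).2
    · rcases y with k | j
      · refine (hvg _ _ _ ?_).le
        simp only [v, Sum.elim_inr, Sum.elim_inl, if_true]
        omega
      · by_cases hj : j = i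
        · rw [hj]
        · refine (hvg _ _ _ ?_).le
          simp only [v, Sum.elim_inr, if_true, hj, if_false]
          omega
    · rcases y with k | l
      · refine hvg _ _ _ ?_
        have := hkm k i
        simp only [v, Sum.elim_inr, Sum.elim_inl, hij, if_false]
        omega
      · exact absurd ⟨l, rfl⟩ hy
  obtain ⟨i₀⟩ := ‹Nonempty I›
  let kbase : G := ⟨Pi.single i₀ m, mem_piAntidiag.2 ⟨by simp, fun _ _ => mem_univ _⟩⟩
  obtain ⟨A, hA, hAc⟩ := hsys.exists_colorful ⟨.inl kbase, by simp⟩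
    (Sum.elim c id) (fun _ => rfl)
  have hdom : ∀ k : G, ∃ i, Sum.inr i ∉ A ∧ ∀ l : G, Sum.inl l ∈ A → k.1 i ≤ l.1 i := by
    intro k
    obtain ⟨i, hi⟩ := hA (.inl k)
    refine ⟨i, fun hiA => ?_, fun l hl => ?_⟩
    · have := hgv _ _ _ (hi _ hiA)
      simp only [v, Sum.elim_inr, Sum.elim_inl, if_true] at this
      omega
    · have := hgv _ _ _ (hi _ hl)
      simpa only [v, Sum.elim_inl, Nat.cast_le] using this
  have hcolA : ∀ i, (∃ k : G, Sum.inl k ∈ A ∧ c k = i) ∨ Sum.inr i ∈ A := fun i => by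
    obtain ⟨a, ha, hai⟩ := mem_image.1 (hAc ▸ mem_univ i)
    rcases a with k | j
    · exact .inl ⟨k, ha, hai⟩
    · exact .inr (by simpa [← hai] using ha)
  obtain ⟨k₀, hk₀⟩ : ∃ k : G, Sum.inl k ∈ A := by
    obtain ⟨i, hi, -⟩ := hdom kbase
    obtain ⟨k, hk, -⟩ := (hcolA i).resolve_right hi
    exact ⟨k, hk⟩
  have hmin : ∀ i, ∃ k ∈ ({k : G | Sum.inl k ∈ A} : Finset G),
      ∀ l ∈ ({k : G | Sum.inl k ∈ A} : Finset G), k.1 i ≤ l.1 i := fun i =>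
    Finset.exists_min_image _ (fun k : G => k.1 i) ⟨k₀, by simpa using hk₀⟩
  choose μ hμ hμle using hmin
  simp only [mem_filter, mem_univ, true_and] at hμ hμle
  let M : I → ℕ := fun i => if Sum.inr i ∈ A then 0 else (μ i).1 i
  have hMle : ∀ l : G, Sum.inl l ∈ A → ∀ i, M i ≤ l.1 i := fun l hl i => by
    simp only [M]
    split_ifs
    · exact Nat.zero_le _
    · exact hμle i l hl
  -- Otherwise some grid point exceeds `M` in every coordinate, against dominance. Hence the grid
  -- points of `A` differ from `M` by at most `n` in each coordinate.
  have hsum : m < ∑ i, (M i + 1) := by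
    by_contra hcon
    push Not at hcon
    let S : ℕ := ∑ i, (M i + 1)
    let k : G := ⟨fun i => (M i + 1) + (if i = i₀ then m - S else 0), mem_piAntidiag.2
      ⟨by
        rw [Finset.sum_add_distrib, Finset.sum_ite_eq' univ i₀]
        simp only [mem_univ, if_true]
        have : S ≤ m := hcon
        change S + (m - S) = m
        omega, fun _ _ => mem_univ _⟩⟩
    obtain ⟨i, hi, hle⟩ := hdom k
    have := hle (μ i) (hμ i)
    simp only [k, M, hi, if_false] at this
    omega
  rw [Finset.sum_add_distrib] at hsum
  simp only [sum_const, card_univ, smul_eq_mul, mul_one, ← hn] at hsum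
  have hle : ∀ l : G, Sum.inl l ∈ A → ∀ i, l.1 i ≤ M i + n := fun l hl i => by
    have h1 := Finset.single_le_sum (f := fun j => l.1 j - M j) (fun _ _ => Nat.zero_le _)
      (mem_univ i)
    have h2 : ∑ j, (l.1 j - M j) + ∑ j, M j = m := by
      rw [← Finset.sum_add_distrib]
      exact (Finset.sum_congr rfl fun j _ => Nat.sub_add_cancel (hMle l hl j)).trans (hG l)
    omega
  refine ⟨p k₀, hp k₀, fun i => ?_⟩
  rcases hcolA i with ⟨k, hk, rfl⟩ | hi
  · refine ⟨p k, hp k, fun j => ?_, ?_⟩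
    · rw [← sub_div, abs_div, abs_of_pos hm']
      gcongr
      have h1 : (M j : ℝ) ≤ k.1 j := by exact_mod_cast hMle k hk j
      have h2 : (M j : ℝ) ≤ k₀.1 j := by exact_mod_cast hMle k₀ hk₀ j
      have h3 : (k.1 j : ℝ) ≤ M j + n := by exact_mod_cast hle k hk j
      have h4 : (k₀.1 j : ℝ) ≤ M j + n := by exact_mod_cast hle k₀ hk₀ j
      rw [abs_le]
      constructor <;> linarith
    · exact (hc k).trans (le_add_of_nonneg_right (by positivity))
  -- A slack element supplies colour `i`: then `M i = 0`, so the `i`-th coordinate is itself at most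
  -- n/m.
  · refine ⟨p k₀, hp k₀, fun j => ?_, ?_⟩
    · rw [sub_self, abs_zero]; positivity
    · have h1 := hle k₀ hk₀ i
      simp only [M, hi, if_true, zero_add] at h1
      have h2 : p k₀ i ≤ n / m := by
        simp only [p]
        gcongr
      exact h2.trans (le_add_of_nonneg_left ((hf (hp k₀)).1 i))

/-- **Brouwer's fixed point theorem** for the standard simplex. -/
theorem exists_fixedPoint_stdSimplex {I : Type*} [Fintype I] [Nonempty I]
    {f : (I → ℝ) → I → ℝ} (hf : Set.MapsTo f (stdSimplex ℝ I) (stdSimplex ℝ I))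
    (hcont : ContinuousOn f (stdSimplex ℝ I)) : ∃ x ∈ stdSimplex ℝ I, f x = x := by
  choose x hx b hb hbx hfb using fun m : ℕ =>
    exists_approx_fixedPoint_stdSimplex hf (Nat.succ_pos m)
  obtain ⟨a, ha, φ, hφ, hlim⟩ := (isCompact_stdSimplex ℝ I).tendsto_subseq hx
  have hzero : Tendsto (fun m => (Fintype.card I : ℝ) / ((φ m).succ : ℕ)) atTop (𝓝 0) :=
    (tendsto_const_div_atTop_nhds_zero_nat _).comp
      ((tendsto_add_atTop_nat 1).comp hφ.tendsto_atTop)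
  have hblim : ∀ i, Tendsto (fun m => b (φ m) i) atTop (𝓝 a) := fun i => by
    rw [tendsto_pi_nhds]
    intro j
    have h1 : Tendsto (fun m => b (φ m) i j - x (φ m) j) atTop (𝓝 0) :=
      squeeze_zero_norm (fun m => hbx (φ m) i j) hzero
    simpa using h1.add (tendsto_pi_nhds.1 hlim j)
  have hle : ∀ i, a i ≤ f a i := fun i => by
    have h1 : Tendsto (fun m => f (b (φ m) i)) atTop (𝓝 (f a)) :=
      (hcont a ha).tendsto.comp
        (tendsto_nhdsWithin_iff.2 ⟨hblim i, .of_forall fun m => hb (φ m) i⟩)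
    have h2 := (tendsto_pi_nhds.1 h1 i).add hzero
    rw [add_zero] at h2
    exact le_of_tendsto_of_tendsto' (tendsto_pi_nhds.1 (hblim i) i) h2 fun m => hfb (φ m) i
  refine ⟨a, ha, funext fun i => ?_⟩
  -- Both sides have coordinate sum 1, so the inequalities are equalities.
  have := (Finset.sum_eq_sum_iff_of_le fun i _ => hle i).1 (ha.2.trans (hf ha).2.symm)
  exact (this i (mem_univ i)).symm

end Brouwer

/-! ### Schauder's theorem from Brouwer's. -/

section Schauder

open Filter Topology Metric

variable {E : Type*} [NormedAddCommGroup E] [NormedSpace ℝ E]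

/-- A continuous self-map of a convex set with values in a compact subset has approximate fixed
points. -/
theorem Convex.exists_norm_sub_le_of_mapsTo_isCompact {s S : Set E} (hs : Convex ℝ s)
    (hne : s.Nonempty) (hS : IsCompact S) (hSs : S ⊆ s) {G : E → E} (hG : ContinuousOn G s)
    (hmaps : Set.MapsTo G s S) {ε : ℝ} (hε : 0 < ε) : ∃ x ∈ s, ‖x - G x‖ ≤ ε := by
  classical
  obtain ⟨t, htS, htfin, htcov⟩ := hS.finite_cover_balls hε
  have : Fintype t := htfin.fintype
  have hts : ∀ i : t, (i : E) ∈ s := fun i => hSs (htS i.2)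
  let w : t → E → ℝ := fun i y => max (ε - ‖(i : E) - y‖) 0
  have hw0 : ∀ i y, 0 ≤ w i y := fun i y => le_max_right _ _
  have hwpos : ∀ y ∈ S, 0 < ∑ i, w i y := fun y hy => by
    obtain ⟨i, hit, hi⟩ := Set.mem_iUnion₂.1 (htcov hy)
    refine Finset.sum_pos' (fun i _ => hw0 i y) ⟨⟨i, hit⟩, Finset.mem_univ _, ?_⟩
    rw [mem_ball, dist_comm, dist_eq_norm] at hi
    exact lt_max_of_lt_left (sub_pos.2 hi)
  have hwc : ∀ i, Continuous (w i) := fun i => by fun_prop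
  let P : (t → ℝ) → E := fun a => ∑ i, a i • (i : E)
  have hPc : Continuous P := by fun_prop
  have hPs : Set.MapsTo P (stdSimplex ℝ t) s := fun a ha =>
    hs.sum_mem (fun i _ => ha.1 i) ha.2 fun i _ => hts i
  -- A fixed point `a` of `φ` makes `P a` an average of net points within ε of `G (P a)`.
  let φ : (t → ℝ) → t → ℝ := fun a i => w i (G (P a)) / ∑ j, w j (G (P a))
  have hGP : ∀ a ∈ stdSimplex ℝ t, 0 < ∑ j, w j (G (P a)) := fun a ha =>
    hwpos _ (hmaps (hPs ha))
  have hφ : Set.MapsTo φ (stdSimplex ℝ t) (stdSimplex ℝ t) := fun a ha => by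
    refine ⟨fun i => div_nonneg (hw0 _ _) (hGP a ha).le, ?_⟩
    rw [← Finset.sum_div, div_self (hGP a ha).ne']
  have hGPc : ContinuousOn (fun a => G (P a)) (stdSimplex ℝ t) :=
    hG.comp hPc.continuousOn hPs
  have hφc : ContinuousOn φ (stdSimplex ℝ t) := by
    refine continuousOn_pi.2 fun i => ContinuousOn.div ((hwc i).comp_continuousOn hGPc) ?_
      fun a ha => (hGP a ha).ne'
    exact continuousOn_finsetSum _ fun j _ => (hwc j).comp_continuousOn hGPc
  have hne' : Nonempty t := by
    obtain ⟨x, hx⟩ := hne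
    obtain ⟨i, hit, -⟩ := Set.mem_iUnion₂.1 (htcov (hmaps hx))
    exact ⟨⟨i, hit⟩⟩
  obtain ⟨a, ha, hfix⟩ := exists_fixedPoint_stdSimplex hφ hφc
  refine ⟨P a, hPs ha, ?_⟩
  have hsub : P a - G (P a) = ∑ i, a i • ((i : E) - G (P a)) := by
    simp only [smul_sub, Finset.sum_sub_distrib, ← Finset.sum_smul, ha.2, one_smul, P]
  calc ‖P a - G (P a)‖ ≤ ∑ i, ‖a i • ((i : E) - G (P a))‖ := by
        rw [hsub]; exact norm_sum_le _ _
    _ ≤ ∑ i, a i * ε := by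
        refine Finset.sum_le_sum fun i _ => ?_
        rw [norm_smul, Real.norm_of_nonneg (ha.1 i)]
        rcases (hw0 i (G (P a))).eq_or_lt with h0 | hpos
        · have : a i = 0 := by
            rw [← hfix]
            simp only [φ, ← h0, zero_div]
          simp [this]
        · have : ‖(i : E) - G (P a)‖ < ε := by
            by_contra hcon
            exact hpos.ne' (max_eq_right (by linarith))
          exact mul_le_mul_of_nonneg_left this.le (ha.1 i)
    _ = ε := by rw [← Finset.sum_mul, ha.2, one_mul]

/-- **Schauder's fixed point theorem**: a continuous self-map of a nonempty convex set with
values in a compact subset has a fixed point. -/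
theorem Convex.exists_fixedPoint_of_mapsTo_isCompact {s S : Set E} (hs : Convex ℝ s)
    (hne : s.Nonempty) (hS : IsCompact S) (hSs : S ⊆ s) {G : E → E} (hG : ContinuousOn G s)
    (hmaps : Set.MapsTo G s S) : ∃ x ∈ s, G x = x := by
  choose x hx hxG using fun n : ℕ => hs.exists_norm_sub_le_of_mapsTo_isCompact hne hS hSs hG
    hmaps (Nat.one_div_pos_of_nat (α := ℝ) (n := n))
  obtain ⟨y, hy, φ, hφ, hlim⟩ := hS.tendsto_subseq fun n => hmaps (hx n)
  have hzero : Tendsto (fun n => x (φ n) - G (x (φ n))) atTop (𝓝 0) :=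
    squeeze_zero_norm (fun n => hxG (φ n))
      (tendsto_one_div_add_atTop_nhds_zero_nat.comp hφ.tendsto_atTop)
  have hxlim : Tendsto (fun n => x (φ n)) atTop (𝓝 y) := by
    simpa using hzero.add hlim
  have hGlim : Tendsto (fun n => G (x (φ n))) atTop (𝓝 (G y)) :=
    (hG y (hSs hy)).tendsto.comp
      (tendsto_nhdsWithin_iff.2 ⟨hxlim, .of_forall fun n => hx (φ n)⟩)
  exact ⟨y, hSs hy, tendsto_nhds_unique hGlim hlim⟩

end Schauder

/-! ### Radial energies, the radial retraction and the main theorem. -/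

namespace Nehari

open Filter Topology

variable {X : Type*} [NormedAddCommGroup X] [NormedSpace ℝ X] {K : ProperCone ℝ X} {T : X → X}
  {F : X → X → X → ℝ} {r : ℝ} {R : EReal}

/-- The integrand of the radial energy, with negative radii replaced by zero. -/
noncomputable def radialIntegrand (K : ProperCone ℝ X) (T : X → X) (F : X → X → X → ℝ)
    (v : coneSphere K 1) (s : ℝ) : ℝ :=
  F (T (max s 0 • (v : X))) (max s 0 • (v : X)) v

theorem continuous_radialIntegrand (hT : IsCompletelyContinuous K T)
    (hF : IsContinuousFunctional K F) :
    Continuous (Function.uncurry (radialIntegrand K T F)) := by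
  have hmem : ∀ p : coneSphere K 1 × ℝ, max p.2 0 • (p.1 : X) ∈ (K : Set X) := fun p =>
    K.smul_mem p.1.2.1 (le_max_right _ _)
  have hray : Continuous fun p : coneSphere K 1 × ℝ => max p.2 0 • (p.1 : X) := by fun_prop
  have hTray : Continuous fun p : coneSphere K 1 × ℝ => T (max p.2 0 • (p.1 : X)) :=
    hT.continuousOn.comp_continuous hray hmem
  exact ContinuousOn.comp_continuous hF
    (hTray.prodMk (hray.prodMk (continuous_subtype_val.comp continuous_fst)))
    fun p => ⟨hT.mapsTo (hmem p), hmem p, p.1.2⟩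

theorem radialEnergy_eq (v : coneSphere K 1) {t : ℝ} (ht : 0 < t) :
    radialEnergy T F v t = ∫ s in (0 : ℝ)..t, radialIntegrand K T F v s := by
  refine intervalIntegral.integral_congr fun s hs => ?_
  rw [Set.uIcc_of_le ht.le] at hs
  simp only [radialIntegrand, max_eq_left hs.1]

/-- The primitive of a jointly continuous integrand is jointly continuous. Positive radii keep the
truncation at zero harmless. -/
theorem tendsto_radialEnergy (hT : IsCompletelyContinuous K T) (hF : IsContinuousFunctional K F)
    {u : ℕ → coneSphere K 1} {v : coneSphere K 1} (hu : Tendsto u atTop (𝓝 v)) {a : ℕ → ℝ}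
    {t : ℝ} (ha : Tendsto a atTop (𝓝 t)) (ha0 : ∀ n, 0 < a n) (ht : 0 < t) :
    Tendsto (fun n => radialEnergy T F (u n) (a n)) atTop (𝓝 (radialEnergy T F v t)) := by
  have hc := intervalIntegral.continuous_parametric_primitive_of_continuous
    (μ := MeasureTheory.volume) (a₀ := 0) (continuous_radialIntegrand hT hF)
  rw [radialEnergy_eq v ht]
  simp only [fun n => radialEnergy_eq (T := T) (F := F) (u n) (ha0 n)]
  exact (hc.tendsto (v, t)).comp (hu.prodMk_nhds ha)

theorem mem_radialInterval {r₀ R₀ t : ℝ} (hr₀ : 0 < r₀) (hr : r ≤ r₀) (hR : (R₀ : EReal) ≤ R)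
    (h1 : r₀ ≤ t) (h2 : t ≤ R₀) : t ∈ radialInterval r R :=
  ⟨hr₀.trans_le h1, hr.trans h1, (EReal.coe_le_coe h2).trans hR⟩

/-- Unique maximizers that stay in a compact part of the radial interval depend continuously on
the direction. -/
theorem continuousOn_of_isUniqueMaximizer (hT : IsCompletelyContinuous K T)
    (hF : IsContinuousFunctional K F) {r₀ R₀ : ℝ} (hr₀ : 0 < r₀) (hr : r ≤ r₀)
    (hR : (R₀ : EReal) ≤ R) {τ : X → ℝ}
    (hτ : ∀ v ∈ coneSphere K 1, IsUniqueMaximizer T F r R v (τ v) ∧ r₀ < τ v ∧ τ v < R₀) :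
    ContinuousOn τ (coneSphere K 1) := by
  rw [continuousOn_iff_continuous_domRestrict, continuous_iff_seqContinuous]
  intro u v hu
  refine isCompact_Icc.tendsto_nhds_of_unique_mapClusterPt (s := Set.Icc r₀ R₀)
    (.of_forall fun n => ⟨(hτ _ (u n).2).2.1.le, (hτ _ (u n).2).2.2.le⟩) fun y hy hcl => ?_
  obtain ⟨φ, hφ, hlim⟩ := hcl.tendsto_subseq
  have hy' := mem_radialInterval hr₀ hr hR hy.1 hy.2
  refine (hτ v v.2).1.2.2 y hy' fun s hs => ?_
  have huφ := hu.comp hφ.tendsto_atTop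
  exact le_of_tendsto_of_tendsto'
    (tendsto_radialEnergy hT hF huφ tendsto_const_nhds (fun _ => hs.1) hs.1)
    (tendsto_radialEnergy hT hF huφ hlim (fun n => hr₀.trans (hτ _ (u (φ n)).2).2.1) hy'.1)
    fun n => (hτ _ (u (φ n)).2).1.2.1 hs

/-- The functional vanishes at an interior maximum point of the radial energy. -/
theorem IsUniqueMaximizer.functional_eq_zero (hT : IsCompletelyContinuous K T)
    (hF : IsContinuousFunctional K F) {r₀ R₀ : ℝ} (hr₀ : 0 < r₀) (hr : r ≤ r₀)
    (hR : (R₀ : EReal) ≤ R) {v : X} (hv : v ∈ coneSphere K 1) {t : ℝ}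
    (ht : IsUniqueMaximizer T F r R v t) (h1 : r₀ < t) (h2 : t < R₀) :
    F (T (t • v)) (t • v) v = 0 := by
  have hc : Continuous (radialIntegrand K T F ⟨v, hv⟩) :=
    (continuous_radialIntegrand hT hF).comp (.prodMk_right _)
  have hd := (hc.integral_hasStrictDerivAt 0 t).hasDerivAt
  have hmax : IsLocalMax (fun t => ∫ s in (0 : ℝ)..t, radialIntegrand K T F ⟨v, hv⟩ s) t := by
    filter_upwards [Ioo_mem_nhds h1 h2] with s hs
    rw [← radialEnergy_eq _ (hr₀.trans hs.1), ← radialEnergy_eq _ ht.1.1]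
    exact ht.2.1 (mem_radialInterval hr₀ hr hR hs.1.le hs.2.le)
  have := hmax.hasDerivAt_eq_zero hd
  simpa only [radialIntegrand, max_eq_left ht.1.1.le] using this

/-- The radial retraction onto the set of vectors whose norm is at most the value of `τ` at
their direction. -/
noncomputable def radialRetraction (τ : X → ℝ) (x : X) : X :=
  min 1 (τ (‖x‖⁻¹ • x) / ‖x‖) • x

theorem inv_norm_smul_mem_coneSphere {x : X} (hx : x ∈ K) (hx0 : x ≠ 0) :
    ‖x‖⁻¹ • x ∈ coneSphere K 1 :=
  ⟨K.smul_mem hx (by positivity), by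
    rw [norm_smul, norm_inv, norm_norm, inv_mul_cancel₀ (norm_ne_zero_iff.2 hx0)]⟩

theorem radialRetraction_of_le {τ : X → ℝ} {x : X} (h : ‖x‖ ≤ τ (‖x‖⁻¹ • x)) :
    radialRetraction τ x = x := by
  rcases eq_or_ne x 0 with rfl | hx0
  · exact smul_zero _
  · rw [radialRetraction, min_eq_left ((one_le_div (norm_pos_iff.2 hx0)).2 h), one_smul]

theorem radialRetraction_of_ge {τ : X → ℝ} {x : X} (hx0 : x ≠ 0) (h : τ (‖x‖⁻¹ • x) ≤ ‖x‖) :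
    radialRetraction τ x = τ (‖x‖⁻¹ • x) • ‖x‖⁻¹ • x := by
  rw [radialRetraction, min_eq_right ((div_le_one (norm_pos_iff.2 hx0)).2 h), div_eq_mul_inv,
    mul_smul]

theorem continuousOn_radialRetraction {τ : X → ℝ} (hτ : ContinuousOn τ (coneSphere K 1))
    {r₀ : ℝ} (hr₀ : 0 < r₀) (hlt : ∀ v ∈ coneSphere K 1, r₀ < τ v) :
    ContinuousOn (radialRetraction τ) K := by
  intro x hx
  rcases eq_or_ne x 0 with rfl | hx0
  -- Since τ > r₀ on unit directions, the retraction is the identity on `K` near 0.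
  · refine continuousWithinAt_id.congr_of_eventuallyEq ?_ (smul_zero _)
    filter_upwards [inter_mem_nhdsWithin _ (Metric.ball_mem_nhds (0 : X) hr₀)] with y hy
    rcases eq_or_ne y 0 with rfl | hy0
    · exact smul_zero _
    · exact radialRetraction_of_le ((mem_ball_zero_iff.1 hy.2).trans
        (hlt _ (inv_norm_smul_mem_coneSphere hy.1 hy0))).le
  · have hcont : ContinuousOn (radialRetraction τ) ((K : Set X) ∩ {0}ᶜ) := by
      have hnorm : ContinuousOn (fun x : X => ‖x‖) ((K : Set X) ∩ {0}ᶜ) :=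
        continuous_norm.continuousOn
      have hne : ∀ y ∈ (K : Set X) ∩ {0}ᶜ, ‖y‖ ≠ 0 := fun y hy => norm_ne_zero_iff.2 hy.2
      refine ContinuousOn.smul (continuousOn_const.inf ?_) continuousOn_id
      refine ContinuousOn.div ?_ hnorm hne
      exact hτ.comp ((hnorm.inv₀ hne).smul continuousOn_id) fun y hy =>
        inv_norm_smul_mem_coneSphere hy.1 hy.2
    exact (hcont x ⟨hx, hx0⟩).mono_of_mem_nhdsWithin
      (inter_mem_nhdsWithin _ (isOpen_compl_singleton.mem_nhds hx0))

theorem smul_mem_closure_U {v : X} (hv : v ∈ coneSphere K 1) {t_v : ℝ}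
    (ht_v : IsUniqueMaximizer T F r R v t_v) {t : ℝ} (h0 : 0 ≤ t) (ht : t ≤ t_v) :
    t • v ∈ closure (U K T F r R) := by
  have hmem : t ∈ closure (Set.Ico 0 t_v) := by
    rw [closure_Ico ht_v.1.1.ne]
    exact ⟨h0, ht⟩
  exact map_mem_closure (f := fun s : ℝ => s • v) (by fun_prop) hmem
    fun s hs => ⟨v, hv, t_v, ht_v, s, hs.1, hs.2, rfl⟩

end Nehari

theorem mainTheorem4 {X : Type*} [NormedAddCommGroup X] [NormedSpace ℝ X] [CompleteSpace X]
    (K : ProperCone ℝ X) (hK : ∃ x ∈ K, x ≠ 0)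
    (T : X → X) (hT : Nehari.IsCompletelyContinuous K T)
    (F : X → X → X → ℝ) (hF : Nehari.IsContinuousFunctional K F)
    (r : ℝ) (R : EReal) (hr : 0 ≤ r) (hrR : (r : EReal) < R)
    (h1 : Nehari.H1 K T F r R) (h5 : Nehari.H5 K F) :
    ∃ u ∈ closure (Nehari.U K T F r R), T u = u := by
  open Nehari in
  obtain ⟨r₀, R₀, hr₀, hrr₀, hrR₀, hR₀, hmax⟩ := h1
  choose! τ hτ using hmax
  have hρc : ContinuousOn (radialRetraction τ) K := continuousOn_radialRetraction
    (continuousOn_of_isUniqueMaximizer hT hF hr₀ hrr₀ hR₀ hτ) hr₀ fun v hv => (hτ v hv).2.1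
  have hρ : Set.MapsTo (radialRetraction τ) K ((K : Set X) ∩ Metric.closedBall 0 R₀) := by
    intro x hx
    rcases eq_or_ne x 0 with rfl | hx0
    · rw [radialRetraction, smul_zero]
      exact ⟨hx, by simpa using (hr₀.trans hrR₀).le⟩
    have hv := inv_norm_smul_mem_coneSphere hx hx0
    obtain ⟨-, hτ1, hτ2⟩ := hτ _ hv
    rw [Set.mem_inter_iff, mem_closedBall_zero_iff]
    rcases le_total ‖x‖ (τ (‖x‖⁻¹ • x)) with h | h
    · rw [radialRetraction_of_le h]
      exact ⟨hx, h.trans hτ2.le⟩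
    · rw [radialRetraction_of_ge hx0 h]
      refine ⟨K.smul_mem hv.1 (hr₀.trans hτ1).le, ?_⟩
      rw [norm_smul, hv.2, mul_one, Real.norm_of_nonneg (hr₀.trans hτ1).le]
      exact hτ2.le
  obtain ⟨x, hx, hfix⟩ := K.convex.exists_fixedPoint_of_mapsTo_isCompact
    (G := fun x => T (radialRetraction τ x)) K.nonempty
    (hT.compact _ Set.inter_subset_left (Metric.isBounded_closedBall.subset Set.inter_subset_right))
    (closure_minimal (Set.image_subset_iff.2 fun y hy => hT.mapsTo hy.1) K.isClosed)
    (hT.continuousOn.comp hρc fun y hy => (hρ hy).1)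
    (fun y hy => subset_closure (Set.mem_image_of_mem T (hρ hy)))
  rcases eq_or_ne x 0 with rfl | hx0
  -- Here 0 is itself fixed; a nonzero vector of `K` gives a ray showing that 0 lies in the closure
  -- of `U`.
  · rw [radialRetraction, smul_zero] at hfix
    obtain ⟨w, hw, hw0⟩ := hK
    have hv := inv_norm_smul_mem_coneSphere hw hw0
    obtain ⟨hm, -, -⟩ := hτ _ hv
    exact ⟨0, by simpa using smul_mem_closure_U hv hm le_rfl hm.1.1.le, hfix⟩
  have hv := inv_norm_smul_mem_coneSphere hx hx0
  obtain ⟨hm, hτ1, hτ2⟩ := hτ _ hv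
  have hn : 0 < ‖x‖ := norm_pos_iff.2 hx0
  rcases le_or_gt ‖x‖ (τ (‖x‖⁻¹ • x)) with h | h
  · rw [radialRetraction_of_le h] at hfix
    refine ⟨x, ?_, hfix⟩
    have := smul_mem_closure_U hv hm hn.le h
    rwa [smul_inv_smul₀ hn.ne'] at this
  · rw [radialRetraction_of_ge hx0 h.le] at hfix
    have hzero := hm.functional_eq_zero hT hF hr₀ hrr₀ hR₀ hv hτ1 hτ2
    rw [hfix] at hzero
    generalize hvdef : ‖x‖⁻¹ • x = v at *
    have hτ0 : 0 < τ v := hr₀.trans hτ1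
    have hxv : x = ‖x‖ • v := by rw [← hvdef, smul_inv_smul₀ hn.ne']
    have hnorm : ‖τ v • v‖ = τ v := by
      rw [norm_smul, hv.2, mul_one, Real.norm_of_nonneg hτ0.le]
    -- The scalar is chosen so that its product with `τ v • v` is `x = T (τ v • v)`.
    have hle := h5 (‖x‖ / τ v) (div_pos hn hτ0) (τ v • v) (K.smul_mem hv.1 hτ0.le)
      (norm_pos_iff.1 (hτ0.trans_eq hnorm.symm)) (by
        rw [hnorm, smul_smul, div_mul_cancel₀ _ hτ0.ne', ← hxv, inv_smul_smul₀ hτ0.ne']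
        exact hzero)
    rw [div_le_one hτ0] at hle
    exact absurd h hle.not_gt
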